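/- All spaces are real. For a Banach space $X$, $B_X$ denotes its closed unit ball. Let $C\subseteq X$ be bounded, closed and convex. A slice of $C$ is a set $S(C,x^*,\alpha)=\{x\in C : x^*(x)>\sup x^*(C)-\alpha\}$ with $x^*\in X^*$ and $\alpha>0$. A point $x_0\in C$ is an almost preserved extreme point (APEP) of $C$ if every relatively weakly open subset $W$ of $C$ with $x_0\in W$ contains a non-empty slice of $C$; it is a preserved extreme point of $C$ if $x_0$ (canonically embedded in $X^{**}$) is an extreme point of the weak$^*$ closure of $C$ in $X^{**}$. Theorem. Let $K$ be a compact Hausdorff space and let $f\in B_{C(K)}$. The following are equivalent: (1) $f$ is an APEP of $B_{C(K)}$; (2) $|f(t)|=1$ for every $t\in K$; (3) $f$ is an extreme point of $B_{C(K)}$; (4) $f$ is a preserved extreme point of $B_{C(K)}$. Moreover, let $(\Omega,\Sigma,\mu)$ be a measure space and let $I$ be a set. (a) A function $g\in B_{L_\infty(\mu)}$ is an APEP of $B_{L_\infty(\mu)}$ if and only if $|g(\omega)|=1$ for $\mu$-a.e. $\omega\in\Omega$. (b) A point $x=(x_i)_{i\in I}\in B_{\ell_\infty(I)}$ is an APEP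 of $B_{\ell_\infty(I)}$ if and only if $|x_i|=1$ for all $i\in I$. -/

import Mathlib

open scoped ENNReal

/-- The open slice `S(C, φ, α) = {x ∈ C : φ x > sup φ(C) - α}` of a bounded set `C` in a real
normed space. -/
noncomputable def openSlice {X : Type*} [NormedAddCommGroup X] [NormedSpace ℝ X]
    (C : Set X) (φ : StrongDual ℝ X) (α : ℝ) : Set X :=
  {x | x ∈ C ∧ sSup (φ '' C) - α < φ x}

/-- `x₀` is an almost preserved extreme point (APEP) of the bounded closed convex set `C`: every
relatively weakly open subset of `C` containing `x₀` contains a non-empty slice of `C`. -/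
def IsAPEP {X : Type*} [NormedAddCommGroup X] [NormedSpace ℝ X] (C : Set X) (x₀ : X) : Prop :=
  x₀ ∈ C ∧ ∀ W : Set (WeakSpace ℝ X), IsOpen W → toWeakSpace ℝ X x₀ ∈ W →
    ∃ (φ : StrongDual ℝ X) (α : ℝ), 0 < α ∧ (openSlice C φ α).Nonempty ∧
      openSlice C φ α ⊆ C ∩ toWeakSpace ℝ X ⁻¹' W

/-- The weak-star closure, in the bidual, of the canonical image of `C`. -/
def bidualWeakStarClosure {X : Type*} [NormedAddCommGroup X] [NormedSpace ℝ X] (C : Set X) :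
    Set (WeakDual ℝ (StrongDual ℝ X)) :=
  closure ((fun x : X => StrongDual.toWeakDual (NormedSpace.inclusionInDoubleDual ℝ X x)) '' C)

/-- `x₀ ∈ C` is a preserved extreme point of `C`: its canonical image is an extreme point of the
weak-star closure of `C` in the bidual. -/
def IsPreservedExtremePoint {X : Type*} [NormedAddCommGroup X] [NormedSpace ℝ X]
    (C : Set X) (x₀ : X) : Prop :=
  x₀ ∈ C ∧ StrongDual.toWeakDual (NormedSpace.inclusionInDoubleDual ℝ X x₀) ∈
    Set.extremePoints ℝ (bidualWeakStarClosure C)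

/-! Both halves are the same argument in the three spaces. If $|f|=1$, then $f(f-g)=|f-g|$ for every
$g$ in the ball, so for any $a$ in the ball the points $a-\frac12 af(f-g)\pm\frac12(f-g)$ stay in
the ball. Letting $a$ almost maximize $\xi$ shows that $g\mapsto\xi(afg)$ almost peaks at $f$ and
controls $|\xi(f-g)|$. Summing finitely many such functionals gives slices around $f$ inside any
weak neighbourhood (`hasWeakSliceBasis_of_forall_exists_operator`). This is stronger than being an
APEP and also forces preserved extremality. If $|f|$ is not identically $1$, some evaluation-type
functional $\varphi$ has $|\varphi(f)|<1$, while the ball is the closed convex hull of its points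
with $|\varphi|\ge1$. Every non-empty slice meets those points, so none fits in $\{|\varphi|<1\}$
(`not_isAPEP_of_subset_closure_convexHull`). -/

/-- Every relatively weakly open subset of `C` containing `x₀` contains a slice of `C` which itself
contains `x₀`. -/
def HasWeakSliceBasis {X : Type*} [NormedAddCommGroup X] [NormedSpace ℝ X]
    (C : Set X) (x₀ : X) : Prop :=
  ∀ W : Set (WeakSpace ℝ X), IsOpen W → toWeakSpace ℝ X x₀ ∈ W →
    ∃ (φ : StrongDual ℝ X) (α : ℝ), 0 < α ∧ x₀ ∈ openSlice C φ α ∧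
      openSlice C φ α ⊆ C ∩ toWeakSpace ℝ X ⁻¹' W

/-! ### Slices, weak neighbourhoods and extremality in a general normed space. -/

section General

variable {X : Type*} [NormedAddCommGroup X] [NormedSpace ℝ X] {C : Set X} {x₀ : X}

lemma continuous_weakSpace_eval (φ : StrongDual ℝ X) :
    Continuous fun x : WeakSpace ℝ X => φ ((toWeakSpace ℝ X).symm x) :=
  WeakBilin.eval_continuous (topDualPairing ℝ X).flip φ

lemma exists_finset_dual_of_isOpen_weakSpace {W : Set (WeakSpace ℝ X)} (hW : IsOpen W)
    (hx : toWeakSpace ℝ X x₀ ∈ W) :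
    ∃ s : Finset (StrongDual ℝ X), ∃ δ > 0, ∀ x : X,
      (∀ ξ ∈ s, |ξ (x₀ - x)| < δ) → toWeakSpace ℝ X x ∈ W := by
  obtain ⟨U, hU, rfl⟩ := isOpen_induced_iff.1 hW
  obtain ⟨s, u, hu, hsu⟩ := isOpen_pi_iff.1 hU _ hx
  have key : ∀ ξ ∈ s, ∃ δ > 0, ∀ x : X, |ξ (x₀ - x)| < δ → ξ x ∈ u ξ := by
    intro ξ hξ
    obtain ⟨δ, hδ, hb⟩ := Metric.isOpen_iff.1 (hu ξ hξ).1 _ (hu ξ hξ).2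
    refine ⟨δ, hδ, fun x hx => hb ?_⟩
    rw [Metric.mem_ball, dist_comm, Real.dist_eq]
    rw [map_sub] at hx
    exact hx
  choose! d hd hdu using key
  have hδ : ∃ δ > 0, ∀ ξ ∈ s, δ ≤ d ξ := by
    rcases s.eq_empty_or_nonempty with rfl | hs
    · exact ⟨1, one_pos, by simp⟩
    · obtain ⟨η, hη, hmin⟩ := s.exists_min_image d hs
      exact ⟨d η, hd η hη, hmin⟩
  obtain ⟨δ, hδ, hle⟩ := hδ
  exact ⟨s, δ, hδ, fun x hx => hsu fun ξ hξ =>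
    hdu ξ hξ x ((hx ξ hξ).trans_le (hle ξ hξ))⟩

lemma Bornology.IsBounded.bddAbove_dual_image (hC : Bornology.IsBounded C)
    (φ : StrongDual ℝ X) : BddAbove (φ '' C) :=
  (φ.lipschitz.isBounded_image hC).bddAbove

lemma HasWeakSliceBasis.isAPEP (h : HasWeakSliceBasis C x₀) (hx : x₀ ∈ C) : IsAPEP C x₀ := by
  refine ⟨hx, fun W hW hxW => ?_⟩
  obtain ⟨φ, α, hα, hmem, hsub⟩ := h W hW hxW
  exact ⟨φ, α, hα, ⟨x₀, hmem⟩, hsub⟩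

/-- A point of the weak-star closure lying in the weak-star open half space of a slice is
approximated by points of that slice. -/
lemma exists_mem_openSlice_of_mem_bidualWeakStarClosure
    {y : WeakDual ℝ (StrongDual ℝ X)} (hy : y ∈ bidualWeakStarClosure C)
    {φ : StrongDual ℝ X} {α : ℝ} (hφ : sSup (φ '' C) - α < y φ) (ξ : StrongDual ℝ X)
    {δ : ℝ} (hδ : δ < |y ξ - ξ x₀|) :
    ∃ x ∈ openSlice C φ α, δ < |ξ x - ξ x₀| := by
  let U : Set (WeakDual ℝ (StrongDual ℝ X)) :=
    {z | sSup (φ '' C) - α < z φ} ∩ {z | δ < |z ξ - ξ x₀|}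
  have hU : IsOpen U :=
    (isOpen_lt continuous_const (WeakDual.eval_continuous φ)).inter
      (isOpen_lt continuous_const (((WeakDual.eval_continuous ξ).sub continuous_const).abs))
  obtain ⟨_, hz, x, hxC, rfl⟩ := mem_closure_iff.1 hy U hU ⟨hφ, hδ⟩
  exact ⟨x, ⟨hxC, hz.1⟩, hz.2⟩

/-- If $x_0$ is a proper convex combination of $y,z$, any half-space containing $x_0$ contains $y$
or $z$. A slice on which $\xi$ is within $\delta$ of $\xi(x_0)$ then contradicts the weak-star
approximation of that point from the slice. -/
lemma HasWeakSliceBasis.isPreservedExtremePoint (h : HasWeakSliceBasis C x₀) (hx : x₀ ∈ C) :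
    IsPreservedExtremePoint C x₀ := by
  refine ⟨hx, subset_closure ⟨x₀, hx, rfl⟩, ?_⟩
  rintro y hy z hz ⟨a, b, ha, hb, hab, hyz⟩
  have heq : ∀ ξ : StrongDual ℝ X, a * y ξ + b * z ξ = ξ x₀ := fun ξ => by
    have := congrArg (fun w : WeakDual ℝ (StrongDual ℝ X) => w ξ) hyz
    exact this
  by_contra hne
  obtain ⟨ξ, hξ⟩ : ∃ ξ : StrongDual ℝ X, y ξ ≠ ξ x₀ := by
    by_contra! hall
    exact hne (DFunLike.ext _ _ hall)
  -- The same $\xi$ must separate $z$ too, since it is not known which of $y,z$ lies in the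
  -- half-space.
  have hξz : z ξ ≠ ξ x₀ := by
    intro hzξ
    have h1 := heq ξ
    rw [hzξ] at h1
    apply hξ
    have h2 : a * (y ξ - ξ x₀) = 0 := by linear_combination h1 - ξ x₀ * hab
    rcases mul_eq_zero.1 h2 with h3 | h3
    · exact absurd h3 ha.ne'
    · linarith
  obtain ⟨δ, hδ, hδ'⟩ :=
    exists_between (lt_min (abs_pos.2 (sub_ne_zero.2 hξ)) (abs_pos.2 (sub_ne_zero.2 hξz)))
  obtain ⟨φ, α, -, hmem, hsub⟩ := h {x | |ξ ((toWeakSpace ℝ X).symm x) - ξ x₀| < δ}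
    (isOpen_lt ((continuous_weakSpace_eval ξ).sub continuous_const).abs continuous_const)
    (by simpa using hδ)
  have hcase : sSup (φ '' C) - α < y φ ∨ sSup (φ '' C) - α < z φ := by
    by_contra! hcon
    have h1 := heq φ
    have h2 := hmem.2
    have h3 := mul_le_mul_of_nonneg_left hcon.1 ha.le
    have h4 := mul_le_mul_of_nonneg_left hcon.2 hb.le
    have h5 : a * (sSup (φ '' C) - α) + b * (sSup (φ '' C) - α) = sSup (φ '' C) - α := by
      rw [← add_mul, hab, one_mul]
    linarith
  have hfalse : ∀ w ∈ bidualWeakStarClosure C, sSup (φ '' C) - α < w φ →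
      δ < |w ξ - ξ x₀| → False := by
    intro w hw hwφ hwδ
    obtain ⟨x, hxs, hxδ⟩ := exists_mem_openSlice_of_mem_bidualWeakStarClosure hw hwφ ξ hwδ
    have : |ξ x - ξ x₀| < δ := (hsub hxs).2
    exact lt_asymm this hxδ
  rcases hcase with hc | hc
  · exact hfalse y hy hc (hδ'.trans_le (min_le_left _ _))
  · exact hfalse z hz hc (hδ'.trans_le (min_le_right _ _))

lemma IsPreservedExtremePoint.mem_extremePoints (h : IsPreservedExtremePoint C x₀) :
    x₀ ∈ Set.extremePoints ℝ C := by
  refine ⟨h.1, fun y hy z hz hyz => ?_⟩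
  obtain ⟨a, b, ha, hb, hab, rfl⟩ := hyz
  have := h.2.2 (subset_closure ⟨y, hy, rfl⟩) (subset_closure ⟨z, hz, rfl⟩)
    ⟨a, b, ha, hb, hab, by simp⟩
  exact (NormedSpace.inclusionInDoubleDualLi (E := X) ℝ).injective
    (StrongDual.toWeakDual.injective this)

/-- If for each `c ∈ C` there is an operator `T` such that `c - ½ T h ± ½ h` lies in `C` for all
`h = x₀ - g`, `g ∈ C`, then the slices containing `x₀` form a basis of weak neighbourhoods of `x₀`
in `C`: for `c` almost maximizing a functional `ξ`, the functional `ξ ∘ T` almost dominates `|ξ|`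
on `x₀ - C`. -/
lemma hasWeakSliceBasis_of_forall_exists_operator (hC : Bornology.IsBounded C) (hx : x₀ ∈ C)
    (H : ∀ c ∈ C, ∃ T : X →L[ℝ] X, ∀ g ∈ C,
      c - (1 / 2 : ℝ) • T (x₀ - g) + (1 / 2 : ℝ) • (x₀ - g) ∈ C ∧
      c - (1 / 2 : ℝ) • T (x₀ - g) - (1 / 2 : ℝ) • (x₀ - g) ∈ C) :
    HasWeakSliceBasis C x₀ := by
  intro W hW hxW
  obtain ⟨s, δ, hδ, hs⟩ := exists_finset_dual_of_isOpen_weakSpace hW hxW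
  set n : ℝ := (s.card : ℝ) with hndef
  have hn : 0 ≤ n := Nat.cast_nonneg _
  -- The budget is $2n\varepsilon$ from the $n$ errors in `key`, plus the slice depth
  -- $2n\varepsilon+\varepsilon$; the extra $\varepsilon$ makes $x_0$ lie strictly inside the slice.
  obtain ⟨ε, hε, hεδ⟩ : ∃ ε > 0, 4 * n * ε + ε = δ :=
    ⟨δ / (4 * n + 1), by positivity, by field_simp⟩
  have key : ∀ ξ : StrongDual ℝ X, ∃ ψ : StrongDual ℝ X, ∀ g ∈ C,
      |ξ (x₀ - g)| < 2 * ε + ψ (x₀ - g) := by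
    intro ξ
    obtain ⟨_, ⟨c, hc, rfl⟩, hlt⟩ :=
      exists_lt_of_lt_csSup (Set.Nonempty.image ξ ⟨x₀, hx⟩) (sub_lt_self (sSup (ξ '' C)) hε)
    obtain ⟨T, hT⟩ := H c hc
    refine ⟨ξ.comp T, fun g hg => ?_⟩
    have h1 := le_csSup (hC.bddAbove_dual_image ξ) (Set.mem_image_of_mem ξ (hT g hg).1)
    have h2 := le_csSup (hC.bddAbove_dual_image ξ) (Set.mem_image_of_mem ξ (hT g hg).2)
    rw [map_add, map_sub, map_smul, map_smul, smul_eq_mul, smul_eq_mul] at h1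
    rw [map_sub, map_sub, map_smul, map_smul, smul_eq_mul, smul_eq_mul] at h2
    rw [ContinuousLinearMap.comp_apply, abs_lt]
    constructor <;> linarith
  choose ψ hψ using key
  have hsum : ∀ g ∈ C, ∀ ξ ∈ s, |ξ (x₀ - g)| < 2 * n * ε + (∑ ξ ∈ s, ψ ξ) (x₀ - g) := by
    intro g hg ξ hξ
    refine (hψ ξ g hg).trans_le ?_
    -- Each term dominates an absolute value, hence is nonnegative, so one functional $\Psi$ serves
    -- all $\xi\in s$.
    have h1 := Finset.single_le_sum (f := fun ξ => 2 * ε + ψ ξ (x₀ - g))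
      (fun η _ => (abs_nonneg _).trans (hψ η g hg).le) hξ
    rw [Finset.sum_add_distrib, Finset.sum_const, nsmul_eq_mul] at h1
    rw [sum_apply]
    linarith
  have hnonneg : ∀ g ∈ C, 0 ≤ 2 * n * ε + (∑ ξ ∈ s, ψ ξ) (x₀ - g) := by
    intro g hg
    rcases s.eq_empty_or_nonempty with rfl | ⟨ξ, hξ⟩
    · simp [hndef]
    · exact (abs_nonneg _).trans (hsum g hg ξ hξ).le
  set Ψ : StrongDual ℝ X := ∑ ξ ∈ s, ψ ξ
  have hsup : sSup (Ψ '' C) ≤ Ψ x₀ + 2 * n * ε := by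
    refine csSup_le ⟨_, x₀, hx, rfl⟩ ?_
    rintro _ ⟨g, hg, rfl⟩
    have := hnonneg g hg
    rw [map_sub] at this
    linarith
  refine ⟨Ψ, 2 * n * ε + ε, by positivity, ⟨hx, by linarith⟩, fun g hg => ⟨hg.1, hs g ?_⟩⟩
  intro ξ hξ
  have h1 := hsum g hg.1 ξ hξ
  have h2 := le_csSup (hC.bddAbove_dual_image Ψ) (Set.mem_image_of_mem Ψ hx)
  have h3 := hg.2
  rw [map_sub Ψ] at h1
  linarith

/-- A point at which a functional `φ` has absolute value less than `1` is not an APEP if the points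
of `C` at which `|φ| ≥ 1` generate `C` as a closed convex set. -/
lemma not_isAPEP_of_subset_closure_convexHull (φ : StrongDual ℝ X) (hφ : |φ x₀| < 1)
    (H : C ⊆ closure (convexHull ℝ {y ∈ C | 1 ≤ |φ y|})) : ¬ IsAPEP C x₀ := by
  rintro ⟨-, h⟩
  obtain ⟨ψ, α, -, ⟨g, hg⟩, hsub⟩ := h {x | |φ ((toWeakSpace ℝ X).symm x)| < 1}
    (isOpen_lt (continuous_weakSpace_eval φ).abs continuous_const) hφ
  have hle : closure (convexHull ℝ {y ∈ C | 1 ≤ |φ y|}) ⊆ {x | ψ x ≤ sSup (ψ '' C) - α} := by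
    refine closure_minimal (convexHull_min ?_ ?_) (isClosed_le ψ.continuous continuous_const)
    · rintro y ⟨hy, hy1⟩
      by_contra hcon
      have : |φ y| < 1 := (hsub ⟨hy, not_le.1 hcon⟩).2
      exact absurd hy1 (not_le.2 this)
    · exact convex_halfSpace_le ψ.isLinear _
  exact absurd hg.2 (not_lt.2 (hle (H hg.1)))

/-- In the applications $p,q$ take the values $1,-1$ under $\varphi$ and $c=\varphi(x)$, so these
weights reproduce $\varphi(x)$. -/
lemma mem_closure_convexHull_of_forall_exists {S : Set X} {x : X} {c : ℝ} (hc : |c| ≤ 1)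
    (H : ∀ ε > 0, ∃ p ∈ S, ∃ q ∈ S,
      ‖x - (((1 + c) / 2) • p + ((1 - c) / 2) • q)‖ ≤ ε) :
    x ∈ closure (convexHull ℝ S) := by
  rw [Metric.mem_closure_iff]
  intro ε hε
  obtain ⟨p, hp, q, hq, hpq⟩ := H (ε / 2) (half_pos hε)
  rw [abs_le] at hc
  refine ⟨_, segment_subset_convexHull hp hq
    ⟨(1 + c) / 2, (1 - c) / 2, by linarith, by linarith, by ring, rfl⟩, ?_⟩
  rw [dist_eq_norm]
  linarith

end General

/-! ### Scalar inequalities. -/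

section Pointwise

/-- With $\theta=f(f-g)/2=|f-g|/2\in[0,1]$, the quantity is $(1-\theta)a\pm\theta$, a convex
combination of $a$ and $\pm1$. -/
lemma abs_sub_half_mul_add_le_one {a f g : ℝ} (ha : |a| ≤ 1) (hf : |f| = 1) (hg : |g| ≤ 1) :
    |a - 1 / 2 * (a * f * (f - g)) + 1 / 2 * (f - g)| ≤ 1 := by
  rw [abs_le] at *
  rcases eq_or_eq_neg_of_abs_eq hf with rfl | rfl <;> constructor <;> nlinarith

lemma abs_sub_half_mul_sub_le_one {a f g : ℝ} (ha : |a| ≤ 1) (hf : |f| = 1) (hg : |g| ≤ 1) :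
    |a - 1 / 2 * (a * f * (f - g)) - 1 / 2 * (f - g)| ≤ 1 := by
  rw [abs_le] at *
  rcases eq_or_eq_neg_of_abs_eq hf with rfl | rfl <;> constructor <;> nlinarith

lemma abs_add_mul_one_sub_le_one {u h : ℝ} (hu : u ∈ Set.Icc (0 : ℝ) 1) (hh : |h| ≤ 1) :
    |h + u * (1 - h)| ≤ 1 := by
  obtain ⟨h0, h1⟩ := hu
  rw [abs_le] at *
  constructor <;> nlinarith

lemma abs_sub_mul_one_add_le_one {u h : ℝ} (hu : u ∈ Set.Icc (0 : ℝ) 1) (hh : |h| ≤ 1) :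
    |h - u * (1 + h)| ≤ 1 := by
  obtain ⟨h0, h1⟩ := hu
  rw [abs_le] at *
  constructor <;> nlinarith

end Pointwise

/-! ### The space $C(K)$. -/

section ContinuousFunctions

variable {K : Type*} [TopologicalSpace K] [CompactSpace K]

lemma mem_closedBall_continuousMap_iff {f : C(K, ℝ)} :
    f ∈ Metric.closedBall (0 : C(K, ℝ)) 1 ↔ ∀ t, |f t| ≤ 1 := by
  rw [mem_closedBall_zero_iff, ContinuousMap.norm_le _ zero_le_one]
  rfl

lemma ContinuousMap.hasWeakSliceBasis_of_abs_eq_one {f : C(K, ℝ)} (hf : ∀ t, |f t| = 1) :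
    HasWeakSliceBasis (Metric.closedBall (0 : C(K, ℝ)) 1) f := by
  refine hasWeakSliceBasis_of_forall_exists_operator Metric.isBounded_closedBall
    (mem_closedBall_continuousMap_iff.2 fun t => (hf t).le) fun a ha =>
      ⟨ContinuousLinearMap.mul ℝ C(K, ℝ) (a * f), fun g hg => ?_⟩
  rw [mem_closedBall_continuousMap_iff] at ha hg ⊢
  rw [mem_closedBall_continuousMap_iff]
  exact ⟨fun t => abs_sub_half_mul_add_le_one (ha t) (hf t) (hg t),
    fun t => abs_sub_half_mul_sub_le_one (ha t) (hf t) (hg t)⟩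

lemma ContinuousMap.abs_eq_one_of_mem_extremePoints {f : C(K, ℝ)}
    (hf : f ∈ Set.extremePoints ℝ (Metric.closedBall (0 : C(K, ℝ)) 1)) (t : K) : |f t| = 1 := by
  have hb := mem_closedBall_continuousMap_iff.1 hf.1
  have hadd : f + (1 - |f|) ∈ Metric.closedBall (0 : C(K, ℝ)) 1 := by
    refine mem_closedBall_continuousMap_iff.2 fun s => ?_
    change |f s + (1 - |f s|)| ≤ 1
    have := hb s
    rw [abs_le]
    constructor <;> linarith [le_abs_self (f s), neg_abs_le (f s)]
  have hsub : f - (1 - |f|) ∈ Metric.closedBall (0 : C(K, ℝ)) 1 := by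
    refine mem_closedBall_continuousMap_iff.2 fun s => ?_
    change |f s - (1 - |f s|)| ≤ 1
    have := hb s
    rw [abs_le]
    constructor <;> linarith [le_abs_self (f s), neg_abs_le (f s)]
  have h := hf.2 hadd hsub ⟨1 / 2, 1 / 2, by norm_num, by norm_num, by norm_num, by
    ext s
    simp only [ContinuousMap.add_apply, ContinuousMap.smul_apply, ContinuousMap.sub_apply,
      smul_eq_mul]
    ring⟩
  have h1 : f t + (1 - |f t|) = f t := congrArg (fun k : C(K, ℝ) => k t) h
  linarith

lemma ContinuousMap.closedBall_subset_closure_convexHull [T2Space K] (t : K) :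
    Metric.closedBall (0 : C(K, ℝ)) 1 ⊆ closure (convexHull ℝ
      {y ∈ Metric.closedBall (0 : C(K, ℝ)) 1 | 1 ≤ |ContinuousMap.evalCLM ℝ t y|}) := by
  intro h hh
  rw [mem_closedBall_continuousMap_iff] at hh
  refine mem_closure_convexHull_of_forall_exists (hh t) fun ε hε => ?_
  have hclosed : IsClosed {s | ε ≤ |h s - h t|} :=
    isClosed_le continuous_const (h.continuous.sub continuous_const).abs
  -- Urysohn: $u$ is $1$ at $t$ and vanishes where $h$ is not within $\varepsilon$ of $h(t)$.
  obtain ⟨u, hu0, hu1, hu⟩ := exists_continuous_zero_one_of_isClosed hclosed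
    (isClosed_singleton (x := t)) (by simpa using hε)
  have hut : u t = 1 := hu1 rfl
  -- Move $h$ towards $1$ and towards $-1$ by the fraction $u$; the weighted average differs from
  -- $h$ by $u(h-h(t))$.
  refine ⟨h + u * (1 - h), ⟨mem_closedBall_continuousMap_iff.2 fun s =>
      abs_add_mul_one_sub_le_one (hu s) (hh s), ?_⟩,
    h - u * (1 + h), ⟨mem_closedBall_continuousMap_iff.2 fun s =>
      abs_sub_mul_one_add_le_one (hu s) (hh s), ?_⟩, ?_⟩
  · change 1 ≤ |h t + u t * (1 - h t)|
    simp [hut]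
  · change 1 ≤ |h t - u t * (1 + h t)|
    simp [hut]
  · refine (ContinuousMap.norm_le _ hε.le).2 fun s => ?_
    have hval : (h - (((1 + h t) / 2) • (h + u * (1 - h)) +
        ((1 - h t) / 2) • (h - u * (1 + h)))) s = u s * (h s - h t) := by
      change h s - ((1 + h t) / 2 * (h s + u s * (1 - h s)) +
        (1 - h t) / 2 * (h s - u s * (1 + h s))) = _
      ring
    rw [hval, Real.norm_eq_abs, abs_mul, abs_of_nonneg (hu s).1]
    by_cases hs : ε ≤ |h s - h t|
    · have : u s = 0 := hu0 hs
      simp [this, hε.le]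
    · exact (mul_le_of_le_one_left (abs_nonneg _) (hu s).2).trans (not_le.1 hs).le

lemma ContinuousMap.abs_eq_one_of_isAPEP [T2Space K] {f : C(K, ℝ)}
    (hf : IsAPEP (Metric.closedBall (0 : C(K, ℝ)) 1) f) (t : K) : |f t| = 1 := by
  by_contra hne
  exact not_isAPEP_of_subset_closure_convexHull (ContinuousMap.evalCLM ℝ t)
    (lt_of_le_of_ne (mem_closedBall_continuousMap_iff.1 hf.1 t) hne)
    (ContinuousMap.closedBall_subset_closure_convexHull t) hf

end ContinuousFunctions

/-! ### The space $\ell_\infty(I)$. -/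

section BoundedFamilies

variable {I : Type*}

lemma mem_closedBall_lp_infty_iff {x : lp (fun _ : I => ℝ) ∞} :
    x ∈ Metric.closedBall (0 : lp (fun _ : I => ℝ) ∞) 1 ↔ ∀ i, |x i| ≤ 1 := by
  rw [mem_closedBall_zero_iff]
  exact ⟨fun h i => (lp.norm_apply_le_norm ENNReal.top_ne_zero x i).trans h,
    fun h => lp.norm_le_of_forall_le zero_le_one h⟩

lemma lp.hasWeakSliceBasis_of_abs_eq_one {x : lp (fun _ : I => ℝ) ∞} (hx : ∀ i, |x i| = 1) :
    HasWeakSliceBasis (Metric.closedBall (0 : lp (fun _ : I => ℝ) ∞) 1) x := by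
  refine hasWeakSliceBasis_of_forall_exists_operator Metric.isBounded_closedBall
    (mem_closedBall_lp_infty_iff.2 fun i => (hx i).le) fun a ha =>
      ⟨ContinuousLinearMap.mul ℝ (lp (fun _ : I => ℝ) ∞) (a * x), fun g hg => ?_⟩
  rw [mem_closedBall_lp_infty_iff] at ha hg ⊢
  rw [mem_closedBall_lp_infty_iff]
  exact ⟨fun i => abs_sub_half_mul_add_le_one (ha i) (hx i) (hg i),
    fun i => abs_sub_half_mul_sub_le_one (ha i) (hx i) (hg i)⟩

lemma lp.closedBall_subset_closure_convexHull (i : I) :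
    Metric.closedBall (0 : lp (fun _ : I => ℝ) ∞) 1 ⊆ closure (convexHull ℝ
      {y ∈ Metric.closedBall (0 : lp (fun _ : I => ℝ) ∞) 1 |
        1 ≤ |lp.evalCLM ℝ (fun _ : I => ℝ) ∞ i y|}) := by
  classical
  intro h hh
  rw [mem_closedBall_lp_infty_iff] at hh
  refine mem_closure_convexHull_of_forall_exists (hh i) fun ε hε => ?_
  -- The unit vector at $i$ replaces the Urysohn function; the approximation is now exact.
  let u : lp (fun _ : I => ℝ) ∞ := lp.single ∞ i 1
  have hui : u i = 1 := lp.single_apply_self ∞ i 1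
  have hu' : ∀ j, j ≠ i → u j = 0 := fun j hj => lp.single_apply_ne ∞ i 1 hj
  have hu : ∀ j, u j ∈ Set.Icc (0 : ℝ) 1 := fun j => by
    by_cases hj : j = i
    · subst hj
      simp [hui]
    · simp [hu' j hj]
  refine ⟨h + u * (1 - h), ⟨mem_closedBall_lp_infty_iff.2 fun s =>
      abs_add_mul_one_sub_le_one (hu s) (hh s), ?_⟩,
    h - u * (1 + h), ⟨mem_closedBall_lp_infty_iff.2 fun s =>
      abs_sub_mul_one_add_le_one (hu s) (hh s), ?_⟩, ?_⟩
  · change 1 ≤ |h i + u i * (1 - h i)|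
    simp [hui]
  · change 1 ≤ |h i - u i * (1 + h i)|
    simp [hui]
  · refine lp.norm_le_of_forall_le hε.le fun s => ?_
    have hval : (h - (((1 + h i) / 2) • (h + u * (1 - h)) +
        ((1 - h i) / 2) • (h - u * (1 + h)))) s = u s * (h s - h i) := by
      change h s - ((1 + h i) / 2 * (h s + u s * (1 - h s)) +
        (1 - h i) / 2 * (h s - u s * (1 + h s))) = _
      ring
    rw [hval]
    by_cases hs : s = i
    · subst hs
      simp [hε.le]
    · simp [hu' s hs, hε.le]

lemma lp.abs_eq_one_of_isAPEP {x : lp (fun _ : I => ℝ) ∞}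
    (hx : IsAPEP (Metric.closedBall (0 : lp (fun _ : I => ℝ) ∞) 1) x) (i : I) : |x i| = 1 := by
  by_contra hne
  exact not_isAPEP_of_subset_closure_convexHull (lp.evalCLM ℝ (fun _ : I => ℝ) ∞ i)
    (lt_of_le_of_ne (mem_closedBall_lp_infty_iff.1 hx.1 i) hne)
    (lp.closedBall_subset_closure_convexHull i) hx

end BoundedFamilies

/-! ### The space $L_\infty(\mu)$, with ultrafilter limits as point evaluations. -/

section EssentiallyBounded

open MeasureTheory Filter Topology

variable {Ω : Type*} [MeasurableSpace Ω] {μ : Measure Ω}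

lemma ae_abs_le_norm_Lp_top (g : Lp ℝ ∞ μ) : ∀ᵐ ω ∂μ, |g ω| ≤ ‖g‖ := by
  filter_upwards [ae_le_eLpNormEssSup (f := g) (μ := μ)] with ω hω
  rw [← eLpNorm_exponent_top] at hω
  have := ENNReal.toReal_mono (Lp.eLpNorm_ne_top g) hω
  rwa [toReal_enorm, Real.norm_eq_abs, ← Lp.norm_def] at this

lemma norm_Lp_top_le_of_ae {g : Lp ℝ ∞ μ} {r : ℝ} (hr : 0 ≤ r) (h : ∀ᵐ ω ∂μ, |g ω| ≤ r) :
    ‖g‖ ≤ r := by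
  rw [Lp.norm_def, eLpNorm_exponent_top]
  exact ENNReal.toReal_le_of_le_ofReal hr (eLpNormEssSup_le_of_ae_bound h)

lemma mem_closedBall_Lp_top_iff {g : Lp ℝ ∞ μ} :
    g ∈ Metric.closedBall (0 : Lp ℝ ∞ μ) 1 ↔ ∀ᵐ ω ∂μ, |g ω| ≤ 1 := by
  rw [mem_closedBall_zero_iff]
  exact ⟨fun h => (ae_abs_le_norm_Lp_top g).mono fun ω hω => hω.trans h,
    norm_Lp_top_le_of_ae zero_le_one⟩

lemma hasWeakSliceBasis_Lp_top_of_abs_eq_one {f : Lp ℝ ∞ μ} (hf : ∀ᵐ ω ∂μ, |f ω| = 1) :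
    HasWeakSliceBasis (Metric.closedBall (0 : Lp ℝ ∞ μ) 1) f := by
  let M : Lp ℝ ∞ μ →L[ℝ] Lp ℝ ∞ μ →L[ℝ] Lp ℝ ∞ μ :=
    (ContinuousLinearMap.mul ℝ ℝ).holderL μ ∞ ∞ ∞
  have hM : ∀ a b : Lp ℝ ∞ μ, M a b =ᵐ[μ] fun ω => a ω * b ω := fun a b =>
    (ContinuousLinearMap.mul ℝ ℝ).coeFn_holder a b
  refine hasWeakSliceBasis_of_forall_exists_operator Metric.isBounded_closedBall
    (mem_closedBall_Lp_top_iff.2 (hf.mono fun ω hω => hω.le)) fun a ha =>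
      ⟨M (M a f), fun g hg => ?_⟩
  rw [mem_closedBall_Lp_top_iff] at ha hg ⊢
  rw [mem_closedBall_Lp_top_iff]
  constructor
  · filter_upwards [ha, hg, hf, hM a f, hM (M a f) (f - g), Lp.coeFn_sub f g,
      Lp.coeFn_add (a - (1 / 2 : ℝ) • M (M a f) (f - g)) ((1 / 2 : ℝ) • (f - g)),
      Lp.coeFn_sub a ((1 / 2 : ℝ) • M (M a f) (f - g)),
      Lp.coeFn_smul (1 / 2 : ℝ) (M (M a f) (f - g)),
      Lp.coeFn_smul (1 / 2 : ℝ) (f - g)] with ω h1 h2 h3 h4 h5 h6 h7 h8 h9 h10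
    rw [h7, Pi.add_apply, h8, Pi.sub_apply, h9, h10, Pi.smul_apply, Pi.smul_apply, h5, h4, h6,
      Pi.sub_apply, smul_eq_mul, smul_eq_mul]
    exact abs_sub_half_mul_add_le_one h1 h3 h2
  · filter_upwards [ha, hg, hf, hM a f, hM (M a f) (f - g), Lp.coeFn_sub f g,
      Lp.coeFn_sub (a - (1 / 2 : ℝ) • M (M a f) (f - g)) ((1 / 2 : ℝ) • (f - g)),
      Lp.coeFn_sub a ((1 / 2 : ℝ) • M (M a f) (f - g)),
      Lp.coeFn_smul (1 / 2 : ℝ) (M (M a f) (f - g)),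
      Lp.coeFn_smul (1 / 2 : ℝ) (f - g)] with ω h1 h2 h3 h4 h5 h6 h7 h8 h9 h10
    rw [h7, Pi.sub_apply, h8, Pi.sub_apply, h9, h10, Pi.smul_apply, Pi.smul_apply, h5, h4, h6,
      Pi.sub_apply, smul_eq_mul, smul_eq_mul]
    exact abs_sub_half_mul_sub_le_one h1 h3 h2

/-- The limit along an ultrafilter containing all conull sets is a continuous functional on
`L∞`. -/
lemma exists_dual_Lp_top_tendsto_ultrafilter (𝒰 : Ultrafilter Ω) (h𝒰 : (𝒰 : Filter Ω) ≤ ae μ) :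
    ∃ φ : StrongDual ℝ (Lp ℝ ∞ μ), ∀ g : Lp ℝ ∞ μ, Tendsto g 𝒰 (𝓝 (φ g)) := by
  have hex : ∀ g : Lp ℝ ∞ μ, ∃ c, c ∈ Set.Icc (-‖g‖) ‖g‖ ∧ Tendsto g 𝒰 (𝓝 c) := by
    intro g
    have hmem : ∀ᶠ ω in (𝒰 : Filter Ω), g ω ∈ Set.Icc (-‖g‖) ‖g‖ :=
      h𝒰 ((ae_abs_le_norm_Lp_top g).mono fun ω hω => abs_le.1 hω)
    exact isCompact_Icc.ultrafilter_le_nhds (𝒰.map g) (le_principal_iff.2 hmem)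
  choose L hL hlim using hex
  let φ : Lp ℝ ∞ μ →ₗ[ℝ] ℝ :=
    { toFun := L
      map_add' := fun f g => tendsto_nhds_unique (hlim (f + g))
        (((hlim f).add (hlim g)).congr' (h𝒰 (Lp.coeFn_add f g).symm))
      map_smul' := fun c g => tendsto_nhds_unique (hlim (c • g))
        (((hlim g).const_mul c).congr' (h𝒰 (Lp.coeFn_smul c g).symm)) }
  exact ⟨φ.mkContinuous 1 fun g => by
    rw [one_mul]
    exact abs_le.2 (hL g), hlim⟩

lemma closedBall_Lp_top_subset_closure_convexHull (𝒰 : Ultrafilter Ω)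
    (h𝒰 : (𝒰 : Filter Ω) ≤ ae μ) {φ : StrongDual ℝ (Lp ℝ ∞ μ)}
    (hφ : ∀ g : Lp ℝ ∞ μ, Tendsto g 𝒰 (𝓝 (φ g))) :
    Metric.closedBall (0 : Lp ℝ ∞ μ) 1 ⊆ closure (convexHull ℝ
      {y ∈ Metric.closedBall (0 : Lp ℝ ∞ μ) 1 | 1 ≤ |φ y|}) := by
  classical
  intro h hh
  rw [mem_closedBall_Lp_top_iff] at hh
  have hc : |φ h| ≤ 1 := le_of_tendsto (hφ h).abs (h𝒰 hh)
  refine mem_closure_convexHull_of_forall_exists hc fun ε hε => ?_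
  -- On $E$, a set in the ultrafilter, $h$ is nearly constant; replacing it there by $\pm1$ gives
  -- $p,q$ with $\varphi$-values $\pm1$.
  set E : Set Ω := {ω | |h ω - φ h| < ε}
  have hE𝒰 : ∀ᶠ ω in (𝒰 : Filter Ω), ω ∈ E := by
    filter_upwards [(hφ h).eventually (Metric.ball_mem_nhds _ hε)] with ω hω
    rwa [Real.dist_eq] at hω
  have hE : MeasurableSet E :=
    measurableSet_lt ((Lp.stronglyMeasurable h).measurable.sub_const _).abs measurable_const
  have key : ∀ v : ℝ, |v| = 1 → ∃ p : Lp ℝ ∞ μ,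
      (p ∈ Metric.closedBall (0 : Lp ℝ ∞ μ) 1 ∧ 1 ≤ |φ p|) ∧
        p =ᵐ[μ] fun ω => if ω ∈ E then v else h ω := by
    intro v hv
    have hmeas : AEStronglyMeasurable (fun ω => if ω ∈ E then v else h ω) μ :=
      (StronglyMeasurable.ite hE stronglyMeasurable_const
        (Lp.stronglyMeasurable h)).aestronglyMeasurable
    have hbound : ∀ᵐ ω ∂μ, ‖if ω ∈ E then v else h ω‖ ≤ 1 := by
      filter_upwards [hh] with ω hω
      split_ifs
      · exact hv.le
      · exact hω
    have hmem : MemLp (fun ω => if ω ∈ E then v else h ω) ∞ μ := memLp_top_of_bound hmeas 1 hbound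
    have hcoe := hmem.coeFn_toLp
    refine ⟨hmem.toLp _, ⟨mem_closedBall_Lp_top_iff.2 ?_, ?_⟩, hcoe⟩
    · filter_upwards [hcoe, hbound] with ω h1 h2
      rwa [h1]
    · have hev : ∀ᶠ ω in (𝒰 : Filter Ω), v = hmem.toLp _ ω := by
        filter_upwards [h𝒰 hcoe, hE𝒰] with ω h1 h2
        rw [h1, if_pos h2]
      have := tendsto_nhds_unique (hφ (hmem.toLp _)) (tendsto_const_nhds.congr' hev)
      rw [this, hv]
  obtain ⟨p, hp, hpE⟩ := key 1 (by simp)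
  obtain ⟨q, hq, hqE⟩ := key (-1) (by simp)
  refine ⟨p, hp, q, hq, norm_Lp_top_le_of_ae hε.le ?_⟩
  filter_upwards [hpE, hqE, Lp.coeFn_sub h (((1 + φ h) / 2) • p + ((1 - φ h) / 2) • q),
    Lp.coeFn_add (((1 + φ h) / 2) • p) (((1 - φ h) / 2) • q),
    Lp.coeFn_smul ((1 + φ h) / 2) p, Lp.coeFn_smul ((1 - φ h) / 2) q] with ω h1 h2 h3 h4 h5 h6
  rw [h3, Pi.sub_apply, h4, Pi.add_apply, h5, h6, Pi.smul_apply, Pi.smul_apply, h1, h2,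
    smul_eq_mul, smul_eq_mul]
  split_ifs with hω
  · rw [show h ω - ((1 + φ h) / 2 * 1 + (1 - φ h) / 2 * -1) = h ω - φ h by ring]
    exact le_of_lt hω
  · rw [show h ω - ((1 + φ h) / 2 * h ω + (1 - φ h) / 2 * h ω) = 0 by ring, abs_zero]
    exact hε.le

lemma ae_abs_eq_one_of_isAPEP {g : Lp ℝ ∞ μ}
    (hg : IsAPEP (Metric.closedBall (0 : Lp ℝ ∞ μ) 1) g) : ∀ᵐ ω ∂μ, |g ω| = 1 := by
  have hle := mem_closedBall_Lp_top_iff.1 hg.1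
  have hge : ∀ n : ℕ, ∀ᵐ ω ∂μ, 1 - 1 / ((n : ℝ) + 1) < |g ω| := by
    intro n
    by_contra hcon
    have hfreq : ∃ᶠ ω in ae μ, |g ω| ≤ 1 - 1 / ((n : ℝ) + 1) :=
      (not_eventually.1 hcon).mono fun _ => le_of_not_gt
    have hne : (ae μ ⊓ 𝓟 {ω | |g ω| ≤ 1 - 1 / ((n : ℝ) + 1)}).NeBot :=
      frequently_mem_iff_neBot.1 hfreq
    -- If $|g|$ is bounded away from $1$ on a non-null set, an ultrafilter concentrated there and on
    -- conull sets yields $|\varphi(g)|<1$.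
    let 𝒰 := Ultrafilter.of (ae μ ⊓ 𝓟 {ω | |g ω| ≤ 1 - 1 / ((n : ℝ) + 1)})
    have h𝒰 : (𝒰 : Filter Ω) ≤ ae μ := (Ultrafilter.of_le _).trans inf_le_left
    obtain ⟨φ, hφ⟩ := exists_dual_Lp_top_tendsto_ultrafilter 𝒰 h𝒰
    have hφg : |φ g| ≤ 1 - 1 / ((n : ℝ) + 1) := le_of_tendsto (hφ g).abs
      (le_principal_iff.1 ((Ultrafilter.of_le _).trans inf_le_right))
    have hpos : 0 < 1 / ((n : ℝ) + 1) := Nat.one_div_pos_of_nat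
    exact not_isAPEP_of_subset_closure_convexHull φ (by linarith)
      (closedBall_Lp_top_subset_closure_convexHull 𝒰 h𝒰 hφ) hg
  filter_upwards [hle, ae_all_iff.2 hge] with ω h1 h2
  refine le_antisymm h1 (le_of_forall_sub_le fun ε hε => ?_)
  obtain ⟨n, hn⟩ := exists_nat_one_div_lt hε
  linarith [h2 n]

end EssentiallyBounded

theorem mainTheorem7
    {K : Type*} [TopologicalSpace K] [CompactSpace K] [T2Space K]
    {Ω : Type*} [MeasurableSpace Ω] (μ : MeasureTheory.Measure Ω)
    {I : Type*} :
    (∀ f ∈ Metric.closedBall (0 : C(K, ℝ)) 1,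
      List.TFAE
        [IsAPEP (Metric.closedBall (0 : C(K, ℝ)) 1) f,
         ∀ t : K, |f t| = 1,
         f ∈ Set.extremePoints ℝ (Metric.closedBall (0 : C(K, ℝ)) 1),
         IsPreservedExtremePoint (Metric.closedBall (0 : C(K, ℝ)) 1) f]) ∧
    (∀ g ∈ Metric.closedBall (0 : MeasureTheory.Lp ℝ ∞ μ) 1,
      IsAPEP (Metric.closedBall (0 : MeasureTheory.Lp ℝ ∞ μ) 1) g ↔ ∀ᵐ ω ∂μ, |g ω| = 1) ∧
    (∀ x ∈ Metric.closedBall (0 : lp (fun _ : I => ℝ) ∞) 1,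
      IsAPEP (Metric.closedBall (0 : lp (fun _ : I => ℝ) ∞) 1) x ↔ ∀ i : I, |x i| = 1) := by
  refine ⟨fun f hf => ?_, fun g hg => ?_, fun x hx => ?_⟩
  · tfae_have 1 → 2 := ContinuousMap.abs_eq_one_of_isAPEP
    tfae_have 2 → 1 := fun h => (ContinuousMap.hasWeakSliceBasis_of_abs_eq_one h).isAPEP hf
    tfae_have 2 → 4 := fun h =>
      (ContinuousMap.hasWeakSliceBasis_of_abs_eq_one h).isPreservedExtremePoint hf
    tfae_have 4 → 3 := IsPreservedExtremePoint.mem_extremePoints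
    tfae_have 3 → 2 := ContinuousMap.abs_eq_one_of_mem_extremePoints
    tfae_finish
  · exact ⟨ae_abs_eq_one_of_isAPEP,
      fun h => (hasWeakSliceBasis_Lp_top_of_abs_eq_one h).isAPEP hg⟩
  · exact ⟨lp.abs_eq_one_of_isAPEP, fun h => (lp.hasWeakSliceBasis_of_abs_eq_one h).isAPEP hx⟩
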